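/- Theorem 2.1. Let $n\ge 3$ and $m\ge 1$ be integers and let $\Omega\subset\mathbb{R}^n$ be a bounded domain (nonempty, open, connected) with smooth boundary. For $0\le l\le 2m-2$ let $a^l=(a^l_{i_1\cdots i_l})_{1\le i_1,\dots,i_l\le n}$ be a smooth symmetric tensor field of order $l$ on $\overline\Omega$: its components are complex-valued functions in $C^\infty(\overline\Omega)$ that are symmetric in the indices $i_1,\dots,i_l$. Write $D^{i_1\cdots i_l}=\partial_{x_{i_1}}\cdots\partial_{x_{i_l}}$, taken in the weak sense. Suppose that $$\int_\Omega \Big(\sum_{l=0}^{2m-2}\ \sum_{i_1,\dots,i_l=1}^n a^l_{i_1\cdots i_l}\, D^{i_1\cdots i_l}u\Big)\, v\,dx=0$$ for all complex-valued $u,v\in H^{2m}(\Omega)$ satisfying $\Delta^m u=\Delta^m v=0$ in $\Omega$. Then $a^l=0$ in $\Omega$ for every $0\le l\le 2m-2$. -/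

import Mathlib

open MeasureTheory Set
open scoped ContDiff

noncomputable section

namespace PolyharmonicCalderon

/-- Euclidean space `ℝⁿ`. -/
abbrev Space (n : ℕ) : Type := EuclideanSpace ℝ (Fin n)

/-- The boundary of `Ω` is smooth: near each boundary point, `Ω` is the sublevel set `{ρ < 0}` of a
smooth function `ρ` whose differential does not vanish at that point. -/
def HasSmoothBoundary {n : ℕ} (Ω : Set (Space n)) : Prop :=
  ∀ p ∈ frontier Ω, ∃ (U : Set (Space n)) (ρ : Space n → ℝ),
    IsOpen U ∧ p ∈ U ∧ ContDiffOn ℝ ∞ ρ U ∧ fderiv ℝ ρ p ≠ 0 ∧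
      ∀ x ∈ U, x ∈ Ω ↔ ρ x < 0

/-- A bounded domain (nonempty connected open set) of `ℝⁿ` with smooth boundary. -/
structure IsSmoothBoundedDomain {n : ℕ} (Ω : Set (Space n)) : Prop where
  isOpen : IsOpen Ω
  isConnected : IsConnected Ω
  isBounded : Bornology.IsBounded Ω
  smoothBoundary : HasSmoothBoundary Ω

/-- The classical partial derivative `∂_{i₁} ⋯ ∂_{iₗ} φ`, where `I = (i₁, …, iₗ)`. -/
def partialDeriv {n l : ℕ} (I : Fin l → Fin n) (φ : Space n → ℂ) (x : Space n) : ℂ :=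
  iteratedFDeriv ℝ l φ x (fun j => EuclideanSpace.single (I j) (1 : ℝ))

/-- Test functions: smooth functions with compact support contained in `Ω`. -/
structure IsTestFunction {n : ℕ} (Ω : Set (Space n)) (φ : Space n → ℂ) : Prop where
  contDiff : ContDiff ℝ ∞ φ
  hasCompactSupport : HasCompactSupport φ
  tsupport_subset : tsupport φ ⊆ Ω

/-- The locally integrable function `g` is the weak derivative `D^{i₁⋯iₗ} u` in `Ω` of the locally
integrable function `u`. Functions are defined on all of `ℝⁿ`, but only their values in `Ω` enter. -/
structure HasWeakDeriv {n l : ℕ} (Ω : Set (Space n)) (I : Fin l → Fin n)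
    (u g : Space n → ℂ) : Prop where
  locallyIntegrableOn : LocallyIntegrableOn u Ω
  locallyIntegrableOn_deriv : LocallyIntegrableOn g Ω
  integral_eq : ∀ φ : Space n → ℂ, IsTestFunction Ω φ →
    ∫ x in Ω, u x * partialDeriv I φ x = (-1) ^ l * ∫ x in Ω, g x * φ x

/-- A weak derivative is unique up to equality almost everywhere in `Ω`. -/
theorem HasWeakDeriv.ae_eq {n l : ℕ} {Ω : Set (Space n)} (hΩ : IsOpen Ω) {I : Fin l → Fin n}
    {u g g' : Space n → ℂ} (h : HasWeakDeriv Ω I u g) (h' : HasWeakDeriv Ω I u g') :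
    g =ᵐ[volume.restrict Ω] g' := by
  have key : ∀ᵐ x ∂(volume : Measure (Space n)), x ∈ Ω → (g - g') x = 0 := by
    refine hΩ.ae_eq_zero_of_integral_contDiff_smul_eq_zero
      (h.locallyIntegrableOn_deriv.sub h'.locallyIntegrableOn_deriv) ?_
    intro φ hφ hc hs
    have ht : IsTestFunction Ω (fun x => (φ x : ℂ)) := by
      have hsub : tsupport (fun x => (φ x : ℂ)) ⊆ tsupport φ :=
        closure_mono (fun x hx hx0 => hx (by simp [hx0]))
      exact ⟨Complex.ofRealCLM.contDiff.comp hφ, hc.comp_left (g := ((↑) : ℝ → ℂ)) rfl,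
        hsub.trans hs⟩
    have e := (h.integral_eq _ ht).symm.trans (h'.integral_eq _ ht)
    have e' : ∫ x in Ω, g x * (φ x : ℂ) = ∫ x in Ω, g' x * (φ x : ℂ) :=
      mul_left_cancel₀ (pow_ne_zero l (by norm_num : (-1 : ℂ) ≠ 0)) e
    have hint : ∀ f : Space n → ℂ, LocallyIntegrableOn f Ω →
        IntegrableOn (fun x => φ x • f x) (tsupport φ) := fun f hf =>
      (hf.integrableOn_compact_subset hs hc).continuousOn_smul hφ.continuous.continuousOn hc
    have hz : ∀ f : Space n → ℂ, ∀ x, x ∉ tsupport φ → φ x • f x = 0 := fun f x hx => by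
      rw [image_eq_zero_of_notMem_tsupport hx, zero_smul]
    have hi : ∀ f : Space n → ℂ, LocallyIntegrableOn f Ω →
        Integrable (fun x => φ x • f x) := fun f hf =>
      (integrableOn_iff_integrable_of_support_subset
        (fun x hx => by_contra fun hx' => hx (hz f x hx'))).1 (hint f hf)
    have hset : ∀ f : Space n → ℂ, ∫ x in Ω, f x * (φ x : ℂ) = ∫ x, φ x • f x := fun f => by
      rw [← setIntegral_eq_integral_of_forall_compl_eq_zero (s := Ω)
        (fun x hx => hz f x (fun hx' => hx (hs hx')))]
      simp only [Complex.real_smul, mul_comm]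
    simp only [Pi.sub_apply, smul_sub]
    rw [integral_sub (hi _ h.locallyIntegrableOn_deriv) (hi _ h'.locallyIntegrableOn_deriv),
      ← hset, ← hset, e', sub_self]
  rw [Filter.EventuallyEq, ae_restrict_iff' hΩ.measurableSet]
  filter_upwards [key] with x hx hxΩ
  exact sub_eq_zero.1 (hx hxΩ)

open scoped Classical in
/-- The weak derivative `D^{i₁⋯iₗ} u` in `Ω` (a representative of it; zero if there is none). -/
def weakDeriv {n l : ℕ} (Ω : Set (Space n)) (I : Fin l → Fin n) (u : Space n → ℂ) :
    Space n → ℂ :=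
  if h : ∃ g, HasWeakDeriv Ω I u g then h.choose else 0

/-- The chosen representative is the weak derivative. -/
theorem HasWeakDeriv.weakDeriv_ae_eq {n l : ℕ} {Ω : Set (Space n)} (hΩ : IsOpen Ω)
    {I : Fin l → Fin n} {u g : Space n → ℂ} (h : HasWeakDeriv Ω I u g) :
    weakDeriv Ω I u =ᵐ[volume.restrict Ω] g := by
  have hex : ∃ g, HasWeakDeriv Ω I u g := ⟨g, h⟩
  rw [weakDeriv, dif_pos hex]
  exact hex.choose_spec.ae_eq hΩ h

/-- The Sobolev space `H^k(Ω)` of complex-valued functions: `u ∈ L²(Ω)`, and all weak derivatives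
of order at most `k` exist and belong to `L²(Ω)`. -/
def MemH {n : ℕ} (k : ℕ) (Ω : Set (Space n)) (u : Space n → ℂ) : Prop :=
  MemLp u 2 (volume.restrict Ω) ∧
    ∀ l ≤ k, ∀ I : Fin l → Fin n, ∃ g, HasWeakDeriv Ω I u g ∧ MemLp g 2 (volume.restrict Ω)

/-- `Δ^m u = 0` in `Ω`, in the sense of distributions. -/
def IsPolyharmonic {n : ℕ} (m : ℕ) (Ω : Set (Space n)) (u : Space n → ℂ) : Prop :=
  ∀ φ : Space n → ℂ, IsTestFunction Ω φ →
    ∫ x in Ω, u x * (Laplacian.laplacian^[m] φ) x = 0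

/-- `a` is a smooth (complex-valued) symmetric tensor field of order `l` in the closure of `Ω`:
its components `a_{i₁⋯iₗ}` are smooth up to the boundary and symmetric in the indices. -/
structure IsSmoothSymmTensorField {n l : ℕ} (Ω : Set (Space n))
    (a : Space n → (Fin l → Fin n) → ℂ) : Prop where
  contDiffOn : ∀ I, ContDiffOn ℝ ∞ (fun x => a x I) (closure Ω)
  symm : ∀ x ∈ closure Ω, ∀ (σ : Equiv.Perm (Fin l)) (I : Fin l → Fin n), a x (I ∘ σ) = a x I

end PolyharmonicCalderon

end

/-!
The proof tests the identity with solutions that live on a complex plane. For `ξ ≠ 0` and `ζ` in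
`ℝⁿ` take orthonormal `e`, `f` with `e` parallel to `ξ` and `ζ` in the span of `e`, `f`, and put
`Z = e + i f`, `W = e - i f`, `z = Z·x`, `w = W·x`. Both vectors are isotropic, so `Δ` acts on
`F(z) G(w)` as a multiple of `∂_z ∂_w`, and `F(z) G(w)` is polyharmonic of order `m` as soon as one
factor is a polynomial of degree less than `m` (`isPolyharmonic_sep`).

Let `s_{pq}(x)` be the coefficient of `αᵖ β^q` in the full symbol of the operator at `α Z + β W`
(`symbolCoeff`), and `g_{pq} = ∫_Ω s_{pq} e^{c(z+w)}`, where `c = -π i |ξ|`, so that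
`e^{c(z+w)} = e^{-2π i ξ·x}`. For `j, k < m` the pairs
`u = z^{k-i} e^{cz} w^{j-i'}`, `v = zⁱ w^{i'} e^{cw}` combine, by the binomial theorem, to the operator
applied to `(z - z₀)ᵏ e^{cz} (w - w₀)ʲ` and evaluated at the base point `(z₀, w₀)` itself. The
hypothesis therefore says that for each `j < m` the polynomial `∑_p g_{pj} Xᵖ` has a zero of order
`m` at `c`; exchanging the roles of `z` and `w`, so does `∑_q g_{jq} X^q`
(`sum_setIntegral_symbolCoeff`).

Since the operator has order at most `2m - 2`, `g_{pq} = 0` for `p + q > 2m - 2`. These conditions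
force `g = 0`, by descending induction on `j = min(p, q)`: once the larger values of `j` are treated,
the derivative of order `j + 1` of `∑_p g_{pj} Xᵖ` has zeros of order `m - 1 - j` both at `0` and at
`c`, but degree at most `2m - 3 - 2j` (`bidegree_coeff_eq_zero`).

Summing the coefficients back up, the Fourier transform of `x ↦ ∑ₗ ∑_I a^l_I(x) ζ_{i₁} ⋯ ζ_{iₗ}`,
cut off to `Ω`, vanishes away from `0` for every real `ζ`. Fourier inversion makes this function zero
in `Ω`, and a symmetric tensor is determined by the homogeneous polynomial in `ζ` that it defines.
-/

open MeasureTheory Set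
open scoped ContDiff

noncomputable section

namespace PolyharmonicCalderon

variable {n : ℕ}

/-! ### Test functions and integration by parts -/

theorem IsTestFunction.continuous {Ω : Set (Space n)} {φ : Space n → ℂ}
    (h : IsTestFunction Ω φ) : Continuous φ := h.contDiff.continuous

theorem IsTestFunction.fderiv_apply {Ω : Set (Space n)} {φ : Space n → ℂ}
    (h : IsTestFunction Ω φ) (v : Space n) :
    IsTestFunction Ω (fun x => fderiv ℝ φ x v) where
  contDiff := (h.contDiff.fderiv_right (m := ∞) (by simp)).clm_apply contDiff_const
  hasCompactSupport := h.hasCompactSupport.fderiv_apply ℝ v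
  tsupport_subset := (tsupport_fderiv_apply_subset ℝ v).trans h.tsupport_subset

theorem partialDeriv_zero (I : Fin 0 → Fin n) (φ : Space n → ℂ) : partialDeriv I φ = φ := by
  ext x; simp [partialDeriv]

theorem partialDeriv_succ {l : ℕ} (I : Fin (l + 1) → Fin n) {φ : Space n → ℂ}
    (h : ContDiff ℝ ∞ φ) :
    partialDeriv I φ = fun x =>
      fderiv ℝ (partialDeriv (Fin.tail I) φ) x (EuclideanSpace.single (I 0) 1) := by
  ext x
  have hd : DifferentiableAt ℝ (iteratedFDeriv ℝ l φ) x :=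
    (h.differentiable_iteratedFDeriv (m := l) (by exact_mod_cast WithTop.coe_lt_top _)) x
  unfold partialDeriv
  rw [iteratedFDeriv_succ_apply_left, fderiv_continuousMultilinear_apply_const_apply hd]
  rfl

theorem IsTestFunction.partialDeriv {Ω : Set (Space n)} {φ : Space n → ℂ}
    (h : IsTestFunction Ω φ) : ∀ {l : ℕ} (I : Fin l → Fin n), IsTestFunction Ω (partialDeriv I φ)
  | 0, I => by rwa [partialDeriv_zero]
  | l + 1, I => by
    rw [partialDeriv_succ I h.contDiff]
    exact (h.partialDeriv (Fin.tail I)).fderiv_apply _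

theorem laplacian_eq_sum_partialDeriv (φ : Space n → ℂ) :
    Laplacian.laplacian φ = fun x => ∑ i : Fin n, partialDeriv ![i, i] φ x := by
  rw [InnerProductSpace.laplacian_eq_iteratedFDeriv_orthonormalBasis φ
    (EuclideanSpace.basisFun (Fin n) ℝ)]
  ext x
  refine Finset.sum_congr rfl fun i _ => ?_
  unfold partialDeriv
  congr 1
  ext j
  fin_cases j <;> simp

theorem IsTestFunction.sum {ι : Type*} {Ω : Set (Space n)} (s : Finset ι) {φ : ι → Space n → ℂ}
    (h : ∀ i ∈ s, IsTestFunction Ω (φ i)) : IsTestFunction Ω (fun x => ∑ i ∈ s, φ i x) := by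
  classical
  induction s using Finset.induction_on with
  | empty =>
    have h0 : tsupport (fun _ : Space n => (0 : ℂ)) = ∅ := tsupport_eq_empty_iff.2 rfl
    simp only [Finset.sum_empty]
    exact ⟨contDiff_const, HasCompactSupport.zero, by rw [h0]; exact empty_subset _⟩
  | insert i s hi ih =>
    simp only [Finset.sum_insert hi]
    have h1 := h i (Finset.mem_insert_self i s)
    have h2 := ih fun j hj => h j (Finset.mem_insert_of_mem hj)
    exact ⟨h1.contDiff.add h2.contDiff, h1.hasCompactSupport.add h2.hasCompactSupport,
      (tsupport_add _ _).trans (union_subset h1.tsupport_subset h2.tsupport_subset)⟩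

theorem IsTestFunction.laplacian {Ω : Set (Space n)} {φ : Space n → ℂ}
    (h : IsTestFunction Ω φ) : IsTestFunction Ω (Laplacian.laplacian φ) := by
  rw [laplacian_eq_sum_partialDeriv]
  exact .sum _ fun i _ => h.partialDeriv _

theorem IsTestFunction.integrable_mul {Ω : Set (Space n)} {φ f : Space n → ℂ}
    (h : IsTestFunction Ω φ) (hf : Continuous f) : Integrable (fun x => f x * φ x) :=
  (hf.mul h.continuous).integrable_of_hasCompactSupport h.hasCompactSupport.mul_left

theorem IsTestFunction.setIntegral_mul {Ω : Set (Space n)} {φ : Space n → ℂ}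
    (h : IsTestFunction Ω φ) (f : Space n → ℂ) :
    ∫ x in Ω, f x * φ x = ∫ x, f x * φ x :=
  setIntegral_eq_integral_of_forall_compl_eq_zero fun x hx => by
    rw [image_eq_zero_of_notMem_tsupport fun h' => hx (h.tsupport_subset h'), mul_zero]

theorem IsTestFunction.setIntegral_mul_fderiv {Ω : Set (Space n)} {φ u : Space n → ℂ}
    (h : IsTestFunction Ω φ) (hu : ContDiff ℝ 1 u) (v : Space n) :
    ∫ x in Ω, u x * fderiv ℝ φ x v = - ∫ x in Ω, fderiv ℝ u x v * φ x := by
  have hc : Continuous fun x => fderiv ℝ u x v :=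
    (hu.continuous_fderiv one_ne_zero).clm_apply continuous_const
  rw [(h.fderiv_apply v).setIntegral_mul, h.setIntegral_mul]
  exact integral_mul_fderiv_eq_neg_fderiv_mul_of_integrable (h.integrable_mul hc)
    ((h.fderiv_apply v).integrable_mul hu.continuous) (h.integrable_mul hu.continuous)
    (fun x _ => (hu.differentiable one_ne_zero) x)
    (fun x _ => (h.contDiff.differentiable (by simp)) x)

/-! ### Products of functions of two isotropic coordinates -/

/-- The real-linear map `x ↦ ∑ᵢ Zᵢ xᵢ` on `ℝⁿ` defined by a complex vector `Z`. -/
def lin (Z : Fin n → ℂ) : Space n →L[ℝ] ℂ :=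
  ∑ i, (EuclideanSpace.proj i : Space n →L[ℝ] ℝ).smulRight (Z i)

theorem lin_apply (Z : Fin n → ℂ) (x : Space n) : lin Z x = ∑ i, x i * Z i := by
  simp [lin]

theorem lin_single (Z : Fin n → ℂ) (i : Fin n) :
    lin Z (EuclideanSpace.single i (1 : ℝ)) = Z i := by
  simp [lin_apply, apply_ite]

/-- The function `x ↦ F(Z·x) G(W·x)`, built from two complex vectors `Z`, `W` and two functions of
one complex variable. -/
def sep (Z W : Fin n → ℂ) (F G : ℂ → ℂ) (x : Space n) : ℂ := F (lin Z x) * G (lin W x)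

/-- The derivative `∂_{i₁} ⋯ ∂_{iₗ}` of `x ↦ F(Z·x) G(W·x)`, expanded by the Leibniz rule: the choice
`ε` records which of the derivatives fall on the factor `F`. -/
def sepDeriv {l : ℕ} (I : Fin l → Fin n) (Z W : Fin n → ℂ) (F G : ℂ → ℂ) (x : Space n) : ℂ :=
  ∑ ε : Fin l → Bool, (∏ i, if ε i then Z (I i) else W (I i)) *
    sep Z W (iteratedDeriv (∑ i, if ε i then 1 else 0) F)
      (iteratedDeriv (∑ i, if ε i then 0 else 1) G) x

section sep
variable (Z W : Fin n → ℂ) {F G : ℂ → ℂ}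

theorem contDiff_sep (hF : Differentiable ℂ F) (hG : Differentiable ℂ G) {k : ℕ∞} :
    ContDiff ℝ k (sep Z W F G) :=
  ((hF.contDiff.restrict_scalars ℝ).comp (lin Z).contDiff).mul
    ((hG.contDiff.restrict_scalars ℝ).comp (lin W).contDiff)

theorem fderiv_sep (hF : Differentiable ℂ F) (hG : Differentiable ℂ G) (x v : Space n) :
    fderiv ℝ (sep Z W F G) x v =
      lin Z v * sep Z W (deriv F) G x + lin W v * sep Z W F (deriv G) x := by
  have h1 : HasFDerivAt (fun x => F (lin Z x)) _ x :=
    ((hF (lin Z x)).hasDerivAt.hasFDerivAt.restrictScalars ℝ).comp x (lin Z).hasFDerivAt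
  have h2 : HasFDerivAt (fun x => G (lin W x)) _ x :=
    ((hG (lin W x)).hasDerivAt.hasFDerivAt.restrictScalars ℝ).comp x (lin W).hasFDerivAt
  have h3 := (h1.mul h2).fderiv
  change fderiv ℝ (sep Z W F G) x = _ at h3
  rw [h3]
  simp [sep]
  ring

theorem differentiable_iteratedDeriv (hF : Differentiable ℂ F) (k : ℕ) :
    Differentiable ℂ (iteratedDeriv k F) :=
  (hF.contDiff (n := (k + 1 : ℕ))).differentiable_iteratedDeriv k (by exact_mod_cast k.lt_succ_self)

theorem differentiable_deriv (hF : Differentiable ℂ F) : Differentiable ℂ (deriv F) := by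
  simpa using differentiable_iteratedDeriv hF 1

theorem continuous_sepDeriv (hF : Differentiable ℂ F) (hG : Differentiable ℂ G) {l : ℕ}
    (I : Fin l → Fin n) : Continuous (sepDeriv I Z W F G) :=
  continuous_finsetSum _ fun _ _ => continuous_const.mul
    (contDiff_sep Z W (k := 0) (differentiable_iteratedDeriv hF _)
      (differentiable_iteratedDeriv hG _)).continuous

theorem sepDeriv_zero (I : Fin 0 → Fin n) (F G : ℂ → ℂ) :
    sepDeriv I Z W F G = sep Z W F G := by
  ext x; simp [sepDeriv]

theorem sepDeriv_succ {l : ℕ} (I : Fin (l + 1) → Fin n) (F G : ℂ → ℂ) (x : Space n) :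
    sepDeriv I Z W F G x = Z (I 0) * sepDeriv (Fin.tail I) Z W (deriv F) G x +
      W (I 0) * sepDeriv (Fin.tail I) Z W F (deriv G) x := by
  unfold sepDeriv
  rw [← (Fin.consEquiv fun _ => Bool).sum_comp, Fintype.sum_prod_type, Fintype.sum_bool,
    Finset.mul_sum, Finset.mul_sum]
  congr 1 <;> refine Finset.sum_congr rfl fun ε _ => ?_
  · simp [Fin.prod_univ_succ, Fin.sum_univ_succ, Fin.tail, mul_assoc, add_comm 1,
      iteratedDeriv_succ', -Finset.sum_boole]
  · simp [Fin.prod_univ_succ, Fin.sum_univ_succ, Fin.tail, mul_assoc, add_comm 1,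
      iteratedDeriv_succ', -Finset.sum_boole]

/-- The weak derivatives of `F(Z·x) G(W·x)` are found by moving one derivative at a time off the test
function, so the order of differentiation never has to be interchanged. -/
theorem setIntegral_sep_mul_partialDeriv {Ω : Set (Space n)} : ∀ {l : ℕ} (I : Fin l → Fin n)
    {F G : ℂ → ℂ} (_ : Differentiable ℂ F) (_ : Differentiable ℂ G) {φ : Space n → ℂ}
    (_ : IsTestFunction Ω φ),
    ∫ x in Ω, sep Z W F G x * partialDeriv I φ x =
      (-1) ^ l * ∫ x in Ω, sepDeriv I Z W F G x * φ x
  | 0, I, F, G, _, _, φ, _ => by simp [partialDeriv_zero, sepDeriv_zero]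
  | l + 1, I, F, G, hF, hG, φ, hφ => by
    have hψ := hφ.partialDeriv (Fin.tail I)
    have hF' := differentiable_deriv hF
    have hG' := differentiable_deriv hG
    have i1 : IntegrableOn (fun x => sep Z W (deriv F) G x * partialDeriv (Fin.tail I) φ x) Ω :=
      (hψ.integrable_mul (contDiff_sep Z W (k := 0) hF' hG).continuous).integrableOn
    have i2 : IntegrableOn (fun x => sep Z W F (deriv G) x * partialDeriv (Fin.tail I) φ x) Ω :=
      (hψ.integrable_mul (contDiff_sep Z W (k := 0) hF hG').continuous).integrableOn
    have j1 : IntegrableOn (fun x => sepDeriv (Fin.tail I) Z W (deriv F) G x * φ x) Ω :=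
      (hφ.integrable_mul (continuous_sepDeriv Z W hF' hG _)).integrableOn
    have j2 : IntegrableOn (fun x => sepDeriv (Fin.tail I) Z W F (deriv G) x * φ x) Ω :=
      (hφ.integrable_mul (continuous_sepDeriv Z W hF hG' _)).integrableOn
    rw [partialDeriv_succ I hφ.contDiff,
      hψ.setIntegral_mul_fderiv (contDiff_sep Z W (k := 1) hF hG)]
    simp only [fderiv_sep Z W hF hG, lin_single, sepDeriv_succ, add_mul, mul_assoc]
    rw [integral_add (i1.const_mul _) (i2.const_mul _), integral_const_mul, integral_const_mul,
      setIntegral_sep_mul_partialDeriv (Fin.tail I) hF' hG hφ,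
      setIntegral_sep_mul_partialDeriv (Fin.tail I) hF hG' hφ,
      integral_add (j1.const_mul _) (j2.const_mul _), integral_const_mul, integral_const_mul]
    ring

theorem hasWeakDeriv_sep (Ω : Set (Space n)) {l : ℕ} (I : Fin l → Fin n)
    (hF : Differentiable ℂ F) (hG : Differentiable ℂ G) :
    HasWeakDeriv Ω I (sep Z W F G) (sepDeriv I Z W F G) where
  locallyIntegrableOn :=
    (contDiff_sep Z W (k := 0) hF hG).continuous.locallyIntegrable.locallyIntegrableOn _
  locallyIntegrableOn_deriv :=
    (continuous_sepDeriv Z W hF hG I).locallyIntegrable.locallyIntegrableOn _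
  integral_eq _ hφ := setIntegral_sep_mul_partialDeriv Z W I hF hG hφ

theorem memLp_of_isBounded {Ω : Set (Space n)} (hb : Bornology.IsBounded Ω) {f : Space n → ℂ}
    (hf : Continuous f) : MemLp f 2 (volume.restrict Ω) := by
  have hK : IsCompact (closure Ω) := hb.isCompact_closure
  have : IsFiniteMeasure (volume.restrict (closure Ω) : Measure (Space n)) :=
    ⟨by simpa using hK.measure_lt_top⟩
  obtain ⟨C, hC⟩ := hK.exists_bound_of_continuousOn hf.continuousOn
  have : MemLp f 2 (volume.restrict (closure Ω)) :=
    MemLp.of_bound hf.aestronglyMeasurable C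
      ((ae_restrict_iff' isClosed_closure.measurableSet).2 (Filter.Eventually.of_forall hC))
  exact this.mono_measure (Measure.restrict_mono subset_closure le_rfl)

theorem memH_sep {Ω : Set (Space n)} (hb : Bornology.IsBounded Ω) (k : ℕ)
    (hF : Differentiable ℂ F) (hG : Differentiable ℂ G) : MemH k Ω (sep Z W F G) :=
  ⟨memLp_of_isBounded hb (contDiff_sep Z W (k := 0) hF hG).continuous, fun _ _ I =>
    ⟨_, hasWeakDeriv_sep Z W Ω I hF hG,
      memLp_of_isBounded hb (continuous_sepDeriv Z W hF hG I)⟩⟩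

/-- If `Z` and `W` are isotropic, the Laplacian of `F(Z·x) G(W·x)` is `2 (Z·W) F'(Z·x) G'(W·x)`. -/
theorem setIntegral_sep_mul_laplacian (hZ : ∑ i, Z i * Z i = 0) (hW : ∑ i, W i * W i = 0)
    {Ω : Set (Space n)} (hF : Differentiable ℂ F) (hG : Differentiable ℂ G) {φ : Space n → ℂ}
    (hφ : IsTestFunction Ω φ) :
    ∫ x in Ω, sep Z W F G x * Laplacian.laplacian φ x =
      2 * (∑ i, Z i * W i) * ∫ x in Ω, sep Z W (deriv F) (deriv G) x * φ x := by
  have hc := (contDiff_sep Z W (k := 0) hF hG).continuous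
  simp only [laplacian_eq_sum_partialDeriv, Finset.mul_sum]
  rw [integral_finsetSum _ fun i _ => ((hφ.partialDeriv _).integrable_mul hc).integrableOn]
  simp only [setIntegral_sep_mul_partialDeriv Z W _ hF hG hφ]
  rw [← Finset.mul_sum, ← integral_finsetSum _ fun i _ =>
    (hφ.integrable_mul (continuous_sepDeriv Z W hF hG _)).integrableOn, ← integral_const_mul,
    ← integral_const_mul]
  congr 1
  ext x
  rw [← Finset.sum_mul]
  have : ∑ i, sepDeriv ![i, i] Z W F G x =
      2 * (∑ i, Z i * W i) * sep Z W (deriv F) (deriv G) x := by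
    simp only [sepDeriv_succ, sepDeriv_zero, Fin.tail, Matrix.cons_val_zero, Matrix.cons_val_succ]
    have e : ∀ i, Z i * (Z i * sep Z W (deriv (deriv F)) G x + W i * sep Z W (deriv F) (deriv G) x)
        + W i * (Z i * sep Z W (deriv F) (deriv G) x + W i * sep Z W F (deriv (deriv G)) x) =
        Z i * Z i * sep Z W (deriv (deriv F)) G x + W i * W i * sep Z W F (deriv (deriv G)) x +
        Z i * W i * (2 * sep Z W (deriv F) (deriv G) x) := fun i => by ring
    simp only [e, Finset.sum_add_distrib, ← Finset.sum_mul, hZ, hW]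
    ring
  rw [this, Finset.mul_sum]
  ring

/-- `F(Z·x) G(W·x)` is polyharmonic of order `m` if `Z`, `W` are isotropic and `F⁽ᵐ⁾ = 0` or
`G⁽ᵐ⁾ = 0`. -/
theorem isPolyharmonic_sep (hZ : ∑ i, Z i * Z i = 0) (hW : ∑ i, W i * W i = 0)
    (Ω : Set (Space n)) : ∀ (m : ℕ) {F G : ℂ → ℂ} (_ : Differentiable ℂ F)
    (_ : Differentiable ℂ G) (_ : iteratedDeriv m F = 0 ∨ iteratedDeriv m G = 0),
    IsPolyharmonic m Ω (sep Z W F G)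
  | 0, F, G, _, _, h => fun φ _ => by
    simp only [iteratedDeriv_zero] at h
    rcases h with rfl | rfl <;> simp [sep]
  | m + 1, F, G, hF, hG, h => fun φ hφ => by
    simp only [iteratedDeriv_succ'] at h
    have hψ : ∀ k, IsTestFunction Ω (Laplacian.laplacian^[k] φ) := fun k => by
      induction k with
      | zero => exact hφ
      | succ k ih => rw [Function.iterate_succ_apply']; exact ih.laplacian
    rw [Function.iterate_succ_apply', setIntegral_sep_mul_laplacian Z W hZ hW hF hG (hψ m),
      isPolyharmonic_sep hZ hW Ω m (differentiable_deriv hF) (differentiable_deriv hG) h φ hφ,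
      mul_zero]

end sep

/-! ### Polynomials with a zero of high order and a gap -/

open Polynomial in
/-- A polynomial of degree at most `2m - 2 - j` with no terms of degree in `(j, m)` and a zero of order
`m` at `c ≠ 0` vanishes: its derivative of order `j + 1` has zeros of order `m - 1 - j` at `0` and `c`,
but degree less than `2 (m - 1 - j)`. -/
theorem eq_zero_of_lacunary_of_pow_dvd {c : ℂ} (hc : c ≠ 0) {m j : ℕ} (hj : j < m)
    {P : ℂ[X]} (hdeg : ∀ p, 2 * m - 2 - j < p → P.coeff p = 0)
    (hgap : ∀ p, j < p → p < m → P.coeff p = 0) (hdvd : (X - C c) ^ m ∣ P) : P = 0 := by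
  set D := derivative^[j + 1] P with hD
  have h1 : (X : ℂ[X]) ^ (m - (j + 1)) ∣ D := by
    rw [X_pow_dvd_iff]
    intro d hd
    rw [hD, coeff_iterate_derivative, hgap _ (by lia) (by lia), smul_zero]
  have h2 : (X - C c) ^ (m - (j + 1)) ∣ D := pow_sub_dvd_iterate_derivative_of_pow_dvd _ hdvd
  have hcop : IsCoprime ((X : ℂ[X]) ^ (m - (j + 1))) ((X - C c) ^ (m - (j + 1))) := by
    have := isCoprime_X_sub_C_of_isUnit_sub (R := ℂ) (a := 0) (b := c) (by simpa using hc)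
    simpa using this.pow (m := m - (j + 1)) (n := m - (j + 1))
  have hdvd' := hcop.mul_dvd h1 h2
  have hD0 : D = 0 := by
    by_contra hne
    have hle := natDegree_le_of_dvd hdvd' hne
    rw [natDegree_mul (by simp) (pow_ne_zero _ (X_sub_C_ne_zero c)), natDegree_pow, natDegree_pow,
      natDegree_X, natDegree_X_sub_C] at hle
    apply hne
    rw [← leadingCoeff_eq_zero, leadingCoeff, hD, coeff_iterate_derivative, ← hD, hdeg _ (by lia),
      smul_zero]
  have hcoeff : ∀ p, j < p → P.coeff p = 0 := fun p hp => by
    have h0 : D.coeff (p - (j + 1)) = 0 := by rw [hD0, coeff_zero]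
    rw [hD, coeff_iterate_derivative, Nat.sub_add_cancel hp] at h0
    exact (smul_eq_zero.1 h0).resolve_left (Nat.pos_iff_ne_zero.1 (Nat.descFactorial_pos.2 hp))
  by_contra hne
  have hle := natDegree_le_of_dvd hdvd hne
  rw [natDegree_pow, natDegree_X_sub_C, mul_one] at hle
  exact hne (leadingCoeff_eq_zero.1 (hcoeff _ (by lia)))

open Polynomial in
/-- The preceding statement for the coefficient sequence `b`: the sums in `hroot` are the values at
`c` of the derivatives of `∑ₚ bₚ Xᵖ` of order `k < m`. -/
theorem coeff_eq_zero_of_lacunary_of_sum_eq_zero {c : ℂ} (hc : c ≠ 0) {m j : ℕ} (hj : j < m)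
    {b : ℕ → ℂ} (hdeg : ∀ p, 2 * m - 2 - j < p → b p = 0)
    (hgap : ∀ p, j < p → p < m → b p = 0)
    (hroot : ∀ k < m, ∑ p ∈ Finset.range (2 * m - 1),
      b p * (p.descFactorial k * c ^ (p - k)) = 0) (p : ℕ) : b p = 0 := by
  set P : ℂ[X] := ∑ p ∈ Finset.range (2 * m - 1), C (b p) * X ^ p with hP
  have hco : ∀ p, P.coeff p = b p := fun p => by
    rw [hP, finsetSum_coeff]
    simp only [coeff_C_mul_X_pow]
    rw [Finset.sum_ite_eq]
    split_ifs with h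
    · rfl
    · exact (hdeg p (by rw [Finset.mem_range] at h; lia)).symm
  rw [← hco]
  suffices P = 0 by rw [this, coeff_zero]
  refine eq_zero_of_lacunary_of_pow_dvd hc hj (fun p hp => (hco p).trans (hdeg p hp))
    (fun p h h' => (hco p).trans (hgap p h h')) ?_
  by_cases h0 : P = 0
  · rw [h0]; exact dvd_zero _
  rw [← le_rootMultiplicity_iff h0]
  have := (lt_rootMultiplicity_iff_isRoot_iterate_derivative (n := m - 1) (t := c) h0).2
    fun k hk => ?_
  · lia
  rw [IsRoot, hP, iterate_derivative_sum, eval_finsetSum]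
  rw [← hroot k (by lia)]
  refine Finset.sum_congr rfl fun p _ => ?_
  rw [iterate_derivative_C_mul, iterate_derivative_X_pow_eq_natCast_mul]
  simp

/-- An array `g_{pq}` supported in `p + q ≤ 2m - 2` vanishes if, for each `j < m`, the polynomials
formed from its `j`-th row and its `j`-th column have a zero of order `m` at `c ≠ 0`. The rows and
columns with larger index provide the gap needed for `coeff_eq_zero_of_lacunary_of_sum_eq_zero`. -/
theorem bidegree_coeff_eq_zero {c : ℂ} (hc : c ≠ 0) {m : ℕ} (hm : 1 ≤ m) {g : ℕ → ℕ → ℂ}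
    (hdeg : ∀ p q, 2 * m - 2 < p + q → g p q = 0)
    (h1 : ∀ j < m, ∀ k < m, ∑ p ∈ Finset.range (2 * m - 1),
      g p j * (p.descFactorial k * c ^ (p - k)) = 0)
    (h2 : ∀ j < m, ∀ k < m, ∑ q ∈ Finset.range (2 * m - 1),
      g j q * (q.descFactorial k * c ^ (q - k)) = 0) (p q : ℕ) : g p q = 0 := by
  have key : ∀ d, ∀ j < m, m ≤ j + d → (∀ p, g p j = 0) ∧ ∀ q, g j q = 0 := by
    intro d
    induction d with
    | zero => intro j hj hd; lia
    | succ d ih =>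
      intro j hj hd
      exact ⟨coeff_eq_zero_of_lacunary_of_sum_eq_zero hc hj (fun p hp => hdeg _ _ (by lia))
          (fun p hp hp' => (ih p hp' (by lia)).2 j) (h1 j hj),
        coeff_eq_zero_of_lacunary_of_sum_eq_zero hc hj (fun p hp => hdeg _ _ (by lia))
          (fun p hp hp' => (ih p hp' (by lia)).1 j) (h2 j hj)⟩
  by_cases hp : p < m
  · exact (key m p hp (by lia)).2 q
  by_cases hq : q < m
  · exact (key m q hq (by lia)).1 p
  · exact hdeg _ _ (by lia)

/-! ### The symbol of the operator in two isotropic directions -/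

/-- The coefficient of `αᵖ β^q` in the full symbol
`∑ₗ ∑_I a^l_I(x) ζ_{i₁} ⋯ ζ_{iₗ}` at `ζ = α Z + β W`. -/
def symbolCoeff (m : ℕ) (a : (l : ℕ) → Space n → (Fin l → Fin n) → ℂ) (Z W : Fin n → ℂ)
    (p q : ℕ) (x : Space n) : ℂ :=
  ∑ l ∈ Finset.Icc 0 (2 * m - 2), ∑ I : Fin l → Fin n, a l x I *
    ∑ ε : Fin l → Bool, if (∑ i, if ε i then 1 else 0) = p ∧ (∑ i, if ε i then 0 else 1) = q then
      ∏ i, (if ε i then Z (I i) else W (I i)) else 0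

theorem sum_count_add_sum_count {l : ℕ} (ε : Fin l → Bool) :
    (∑ i, if ε i then 1 else 0) + (∑ i, if ε i then 0 else 1) = l := by
  rw [← Finset.sum_add_distrib]
  have : ∀ i, ((if ε i then 1 else 0) + (if ε i then 0 else 1) : ℕ) = 1 := fun i => by
    split_ifs <;> rfl
  simp [this]

theorem symbolCoeff_eq_zero {m : ℕ} (a : (l : ℕ) → Space n → (Fin l → Fin n) → ℂ)
    (Z W : Fin n → ℂ) {p q : ℕ} (h : 2 * m - 2 < p + q) (x : Space n) :
    symbolCoeff m a Z W p q x = 0 := by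
  unfold symbolCoeff
  refine Finset.sum_eq_zero fun l hl => Finset.sum_eq_zero fun I _ => ?_
  rw [Finset.sum_eq_zero, mul_zero]
  intro ε _
  rw [if_neg]
  rintro ⟨rfl, rfl⟩
  rw [sum_count_add_sum_count] at h
  exact absurd (Finset.mem_Icc.1 hl).2 (by lia)

/-- Sorting the terms of a sum over all `l`, `I`, `ε` by the numbers `p`, `q` of indices assigned to `Z`
and to `W`. -/
theorem sum_symbolCoeff_mul {m : ℕ} (hm : 1 ≤ m) (a : (l : ℕ) → Space n → (Fin l → Fin n) → ℂ)
    (Z W : Fin n → ℂ) (h : ℕ → ℕ → ℂ) (x : Space n) :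
    ∑ l ∈ Finset.Icc 0 (2 * m - 2), ∑ I : Fin l → Fin n, a l x I *
      ∑ ε : Fin l → Bool, (∏ i, if ε i then Z (I i) else W (I i)) *
        h (∑ i, if ε i then 1 else 0) (∑ i, if ε i then 0 else 1) =
    ∑ p ∈ Finset.range (2 * m - 1), ∑ q ∈ Finset.range (2 * m - 1),
      symbolCoeff m a Z W p q x * h p q := by
  have e : ∀ l ∈ Finset.Icc 0 (2 * m - 2), ∀ (I : Fin l → Fin n) (ε : Fin l → Bool),
      (∏ i, if ε i then Z (I i) else W (I i)) *
        h (∑ i, if ε i then 1 else 0) (∑ i, if ε i then 0 else 1) =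
      ∑ p ∈ Finset.range (2 * m - 1), ∑ q ∈ Finset.range (2 * m - 1),
        (if (∑ i, if ε i then 1 else 0) = p ∧ (∑ i, if ε i then 0 else 1) = q then
          ∏ i, (if ε i then Z (I i) else W (I i)) else 0) * h p q := by
    intro l hl I ε
    have hl' := (Finset.mem_Icc.1 hl).2
    have hs := sum_count_add_sum_count ε
    generalize (∑ i, if ε i then 1 else 0) = P at *
    generalize (∑ i, if ε i then 0 else 1) = Q at *
    rw [Finset.sum_eq_single P, Finset.sum_eq_single Q]
    · simp
    · intro q _ hq
      simp [hq.symm]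
    · intro hQ
      exact absurd (Finset.mem_range.2 (by lia)) hQ
    · intro p _ hp
      simp [hp.symm]
    · intro hP
      exact absurd (Finset.mem_range.2 (by lia)) hP
  have e2 : ∀ p q, symbolCoeff m a Z W p q x * h p q =
      ∑ l ∈ Finset.Icc 0 (2 * m - 2), ∑ I : Fin l → Fin n, ∑ ε : Fin l → Bool,
        a l x I * ((if (∑ i, if ε i then 1 else 0) = p ∧ (∑ i, if ε i then 0 else 1) = q then
          ∏ i, (if ε i then Z (I i) else W (I i)) else 0) * h p q) := fun p q => by
    simp only [symbolCoeff, Finset.sum_mul, Finset.mul_sum, mul_assoc]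
  simp only [e2]
  rw [Finset.sum_congr rfl fun p _ => Finset.sum_comm, Finset.sum_comm]
  refine Finset.sum_congr rfl fun l hl => ?_
  rw [Finset.sum_congr rfl fun p _ => Finset.sum_comm, Finset.sum_comm]
  refine Finset.sum_congr rfl fun I _ => ?_
  rw [Finset.sum_congr rfl fun p _ => Finset.sum_comm, Finset.sum_comm, Finset.mul_sum]
  refine Finset.sum_congr rfl fun ε _ => ?_
  rw [e l hl, Finset.mul_sum]
  simp only [Finset.mul_sum]

/-- On functions `F(Z·x) G(W·x)` the operator acts through the coefficients of its symbol. -/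
theorem sum_mul_sepDeriv {m : ℕ} (hm : 1 ≤ m) (a : (l : ℕ) → Space n → (Fin l → Fin n) → ℂ)
    (Z W : Fin n → ℂ) (F G : ℂ → ℂ) (x : Space n) :
    ∑ l ∈ Finset.Icc 0 (2 * m - 2), ∑ I : Fin l → Fin n, a l x I * sepDeriv I Z W F G x =
    ∑ p ∈ Finset.range (2 * m - 1), ∑ q ∈ Finset.range (2 * m - 1),
      symbolCoeff m a Z W p q x * (iteratedDeriv p F (lin Z x) * iteratedDeriv q G (lin W x)) :=
  sum_symbolCoeff_mul hm a Z W
    (fun p q => iteratedDeriv p F (lin Z x) * iteratedDeriv q G (lin W x)) x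

/-- The full symbol at `α Z + β W` in terms of its coefficients. -/
theorem sum_mul_prod {m : ℕ} (hm : 1 ≤ m) (a : (l : ℕ) → Space n → (Fin l → Fin n) → ℂ)
    (Z W : Fin n → ℂ) (α β : ℂ) (x : Space n) :
    ∑ l ∈ Finset.Icc 0 (2 * m - 2), ∑ I : Fin l → Fin n,
      a l x I * ∏ i, (α * Z (I i) + β * W (I i)) =
    ∑ p ∈ Finset.range (2 * m - 1), ∑ q ∈ Finset.range (2 * m - 1),
      symbolCoeff m a Z W p q x * (α ^ p * β ^ q) := by
  rw [← sum_symbolCoeff_mul hm a Z W (fun p q => α ^ p * β ^ q) x]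
  refine Finset.sum_congr rfl fun l _ => Finset.sum_congr rfl fun I _ => ?_
  congr 1
  have : ∀ i, α * Z (I i) + β * W (I i) =
      ∑ b : Bool, if b then α * Z (I i) else β * W (I i) := fun i => by simp
  simp only [this]
  rw [Finset.prod_univ_sum, Fintype.piFinset_univ]
  refine Finset.sum_congr rfl fun ε _ => ?_
  rw [← Finset.prod_pow_eq_pow_sum, ← Finset.prod_pow_eq_pow_sum, ← Finset.prod_mul_distrib,
    ← Finset.prod_mul_distrib]
  refine Finset.prod_congr rfl fun i _ => ?_
  split_ifs <;> simp [mul_comm]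

theorem continuousOn_symbolCoeff {Ω : Set (Space n)} {m : ℕ}
    {a : (l : ℕ) → Space n → (Fin l → Fin n) → ℂ}
    (ha : ∀ l ≤ 2 * m - 2, IsSmoothSymmTensorField Ω (a l)) (Z W : Fin n → ℂ) (p q : ℕ) :
    ContinuousOn (symbolCoeff m a Z W p q) (closure Ω) :=
  continuousOn_finsetSum _ fun l hl => continuousOn_finsetSum _ fun I _ =>
    ((ha l (Finset.mem_Icc.1 hl).2).contDiffOn I).continuousOn.mul continuousOn_const

theorem integrableOn_of_continuousOn_closure {Ω : Set (Space n)} (hb : Bornology.IsBounded Ω)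
    {f : Space n → ℂ} (hf : ContinuousOn f (closure Ω)) : IntegrableOn f Ω :=
  (hf.integrableOn_compact hb.isCompact_closure).mono_set subset_closure

/-- The hypothesis of the theorem for products of separated functions, with the weak derivatives
replaced by their explicit representatives. -/
theorem setIntegral_sum_sepDeriv_mul {Ω : Set (Space n)} (hΩ : IsSmoothBoundedDomain Ω) {m : ℕ}
    {a : (l : ℕ) → Space n → (Fin l → Fin n) → ℂ}
    (h : ∀ u v : Space n → ℂ, MemH (2 * m) Ω u → MemH (2 * m) Ω v →
      IsPolyharmonic m Ω u → IsPolyharmonic m Ω v →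
      ∫ x in Ω, (∑ l ∈ Finset.Icc 0 (2 * m - 2), ∑ I : Fin l → Fin n,
        a l x I * weakDeriv Ω I u x) * v x = 0)
    {Z W : Fin n → ℂ} (hZ : ∑ i, Z i * Z i = 0) (hW : ∑ i, W i * W i = 0)
    {F G F₂ G₂ : ℂ → ℂ} (hF : Differentiable ℂ F) (hG : Differentiable ℂ G)
    (hF₂ : Differentiable ℂ F₂) (hG₂ : Differentiable ℂ G₂)
    (hFG : iteratedDeriv m F = 0 ∨ iteratedDeriv m G = 0)
    (hFG₂ : iteratedDeriv m F₂ = 0 ∨ iteratedDeriv m G₂ = 0) :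
    ∫ x in Ω, (∑ l ∈ Finset.Icc 0 (2 * m - 2), ∑ I : Fin l → Fin n,
      a l x I * sepDeriv I Z W F G x) * sep Z W F₂ G₂ x = 0 := by
  rw [← h _ _ (memH_sep Z W hΩ.isBounded _ hF hG) (memH_sep Z W hΩ.isBounded _ hF₂ hG₂)
    (isPolyharmonic_sep Z W hZ hW Ω m hF hG hFG) (isPolyharmonic_sep Z W hZ hW Ω m hF₂ hG₂ hFG₂)]
  have hae : ∀ᵐ x ∂(volume.restrict Ω), ∀ (l : ℕ) (I : Fin l → Fin n),
      weakDeriv Ω I (sep Z W F G) x = sepDeriv I Z W F G x :=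
    ae_all_iff.2 fun l => ae_all_iff.2 fun I =>
      (hasWeakDeriv_sep Z W Ω I hF hG).weakDeriv_ae_eq hΩ.isOpen
  refine integral_congr_ae ?_
  filter_upwards [hae] with x hx
  simp only [hx]

/-! ### Vanishing of the coefficients of the symbol -/

/-- The function `t ↦ tᵏ e^{ct}` of a complex variable. -/
def mono (k : ℕ) (c : ℂ) (t : ℂ) : ℂ := t ^ k * Complex.exp (c * t)

theorem differentiable_mono (k : ℕ) (c : ℂ) : Differentiable ℂ (mono k c) := by
  unfold mono; fun_prop

theorem iteratedDeriv_mono_zero {m k : ℕ} (h : k < m) : iteratedDeriv m (mono k 0) = 0 := by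
  have : mono k 0 = (· ^ k) := by ext t; simp [mono]
  ext t
  rw [this, iteratedDeriv_pow, Nat.descFactorial_eq_zero_iff_lt.2 h]
  simp

/-- For `p < k` both sides vanish, whatever the truncated exponent `p - k` is, because the descending
factorial does. -/
theorem iteratedDeriv_sub_pow_mul_exp (p k : ℕ) (c z : ℂ) :
    iteratedDeriv p (fun t => (t - z) ^ k * Complex.exp (c * t)) z =
      p.descFactorial k * c ^ (p - k) * Complex.exp (c * z) := by
  have h1 : ∀ i, iteratedDeriv i (fun t : ℂ => (t - z) ^ k) z =
      if i = k then (k.factorial : ℂ) else 0 := fun i => by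
    rw [congrFun (iteratedDeriv_comp_sub_const i (fun t : ℂ => t ^ k) z) z, iteratedDeriv_pow,
      sub_self]
    split_ifs with h
    · subst h; simp [Nat.descFactorial_self]
    · rcases lt_or_gt_of_ne h with h | h
      · rw [zero_pow (by lia), mul_zero]
      · rw [Nat.descFactorial_eq_zero_iff_lt.2 h]; simp
  rw [iteratedDeriv_fun_mul (by fun_prop) (by fun_prop)]
  simp only [h1, iteratedDeriv_cexp_const_mul]
  rcases le_or_gt k p with h | h
  · rw [Finset.sum_eq_single k]
    · rw [if_pos rfl, Nat.descFactorial_eq_factorial_mul_choose]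
      push_cast
      ring
    · intro i _ hi
      rw [if_neg hi]; ring
    · intro hk
      exact absurd (Finset.mem_range.2 (by lia)) hk
  · rw [Finset.sum_eq_zero, Nat.descFactorial_eq_zero_iff_lt.2 h]
    · simp
    · intro i hi
      rw [if_neg (by rw [Finset.mem_range] at hi; lia)]; ring

/-- Expanding `(t - z)ᵏ e^{ct}` in powers of `t` and differentiating at `t = z`. -/
theorem sum_iteratedDeriv_mono (p k : ℕ) (c z : ℂ) :
    ∑ i ∈ Finset.range (k + 1), iteratedDeriv p (mono (k - i) c) z *
      ((k.choose i) * (-1) ^ i * z ^ i) =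
      p.descFactorial k * c ^ (p - k) * Complex.exp (c * z) := by
  rw [← iteratedDeriv_sub_pow_mul_exp]
  have : (fun t => (t - z) ^ k * Complex.exp (c * t)) = fun t =>
      ∑ i ∈ Finset.range (k + 1), ((k.choose i) * (-1) ^ i * z ^ i) * mono (k - i) c t := by
    ext t
    rw [show t - z = -z + t by ring, add_pow, Finset.sum_mul]
    refine Finset.sum_congr rfl fun i _ => ?_
    rw [mono, neg_pow]
    ring
  rw [this, iteratedDeriv_fun_sum]
  · refine Finset.sum_congr rfl fun i _ => ?_
    rw [iteratedDeriv_const_mul_field, mul_comm]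
  · intro i _
    exact contDiffAt_const.mul (differentiable_mono _ _).contDiff.contDiffAt

/-- The conditions on the integrals of the symbol coefficients obtained from the solutions
`u = z^{k-i} e^{c₁z} w^{j-i'} e^{c₂w}` and `v = zⁱ e^{c₂z} w^{i'} e^{c₁w}`, for `i ≤ k < m` and
`i' ≤ j < m`, where `z = Z·x` and `w = W·x`. They are polyharmonic because `c₁` or `c₂` is zero. -/
theorem sum_setIntegral_symbolCoeff {Ω : Set (Space n)} (hΩ : IsSmoothBoundedDomain Ω) {m : ℕ}
    (hm : 1 ≤ m) {a : (l : ℕ) → Space n → (Fin l → Fin n) → ℂ}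
    (ha : ∀ l ≤ 2 * m - 2, IsSmoothSymmTensorField Ω (a l))
    (h : ∀ u v : Space n → ℂ, MemH (2 * m) Ω u → MemH (2 * m) Ω v →
      IsPolyharmonic m Ω u → IsPolyharmonic m Ω v →
      ∫ x in Ω, (∑ l ∈ Finset.Icc 0 (2 * m - 2), ∑ I : Fin l → Fin n,
        a l x I * weakDeriv Ω I u x) * v x = 0)
    {Z W : Fin n → ℂ} (hZ : ∑ i, Z i * Z i = 0) (hW : ∑ i, W i * W i = 0)
    {c c₁ c₂ : ℂ} (hc : c₁ + c₂ = c) (hc' : c₁ = 0 ∨ c₂ = 0) {j k : ℕ} (hj : j < m) (hk : k < m) :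
    ∑ p ∈ Finset.range (2 * m - 1), ∑ q ∈ Finset.range (2 * m - 1),
      (∫ x in Ω, symbolCoeff m a Z W p q x * Complex.exp (c * (lin Z x + lin W x))) *
        (p.descFactorial k * c₁ ^ (p - k)) * (q.descFactorial j * c₂ ^ (q - j)) = 0 := by
  set b : (i : ℕ) → (i' : ℕ) → Space n → ℂ := fun i i' x =>
    (k.choose i * (-1) ^ i * (j.choose i' * (-1) ^ i')) *
    ((∑ l ∈ Finset.Icc 0 (2 * m - 2), ∑ I : Fin l → Fin n,
      a l x I * sepDeriv I Z W (mono (k - i) c₁) (mono (j - i') c₂) x) *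
        sep Z W (mono i c₂) (mono i' c₁) x) with hb
  have hmon := differentiable_mono
  have hcF : ∀ p, ContinuousOn (fun x : Space n => Complex.exp (p * (lin Z x + lin W x)))
      (closure Ω) := fun p => by fun_prop
  have hint : ∀ i i', IntegrableOn (b i i') Ω := fun i i' => by
    refine integrableOn_of_continuousOn_closure hΩ.isBounded (continuousOn_const.mul
      (ContinuousOn.mul ?_ (contDiff_sep Z W (k := 0) (hmon _ _) (hmon _ _)).continuous.continuousOn))
    exact continuousOn_finsetSum _ fun l hl => continuousOn_finsetSum _ fun I _ =>
      ((ha l (Finset.mem_Icc.1 hl).2).contDiffOn I).continuousOn.mul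
        (continuous_sepDeriv Z W (hmon _ _) (hmon _ _) I).continuousOn
  have hzero : ∀ i ∈ Finset.range (k + 1), ∀ i' ∈ Finset.range (j + 1),
      ∫ x in Ω, b i i' x = 0 := fun i hi i' hi' => by
    rw [Finset.mem_range] at hi hi'
    rw [hb]
    simp only
    rw [integral_const_mul, setIntegral_sum_sepDeriv_mul hΩ h hZ hW (hmon _ _) (hmon _ _)
      (hmon _ _) (hmon _ _), mul_zero]
    · rcases hc' with rfl | rfl
      · exact .inl (iteratedDeriv_mono_zero (by lia))
      · exact .inr (iteratedDeriv_mono_zero (by lia))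
    · rcases hc' with rfl | rfl
      · exact .inr (iteratedDeriv_mono_zero (by lia))
      · exact .inl (iteratedDeriv_mono_zero (by lia))
  have hsum : ∫ x in Ω, ∑ i ∈ Finset.range (k + 1), ∑ i' ∈ Finset.range (j + 1), b i i' x = 0 := by
    rw [integral_finsetSum _ fun i _ => integrable_finsetSum _ fun i' _ => hint i i']
    refine Finset.sum_eq_zero fun i hi => ?_
    rw [integral_finsetSum _ fun i' _ => hint i i']
    exact Finset.sum_eq_zero fun i' hi' => hzero i hi i' hi'
  -- Pointwise, the binomial sums over `i` and `i'` recentre both factors at the point itself.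
  have hpt : ∀ x, ∑ i ∈ Finset.range (k + 1), ∑ i' ∈ Finset.range (j + 1), b i i' x =
      ∑ p ∈ Finset.range (2 * m - 1), ∑ q ∈ Finset.range (2 * m - 1),
        symbolCoeff m a Z W p q x * Complex.exp (c * (lin Z x + lin W x)) *
        (p.descFactorial k * c₁ ^ (p - k)) * (q.descFactorial j * c₂ ^ (q - j)) := by
    intro x
    set z := lin Z x
    set w := lin W x
    have e1 : ∀ i i', b i i' x = ∑ p ∈ Finset.range (2 * m - 1), ∑ q ∈ Finset.range (2 * m - 1),
        symbolCoeff m a Z W p q x * (Complex.exp (c₂ * z) * Complex.exp (c₁ * w)) *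
        (iteratedDeriv p (mono (k - i) c₁) z * (k.choose i * (-1) ^ i * z ^ i)) *
        (iteratedDeriv q (mono (j - i') c₂) w * (j.choose i' * (-1) ^ i' * w ^ i')) := by
      intro i i'
      simp only [hb, sum_mul_sepDeriv hm, Finset.sum_mul, Finset.mul_sum, sep, mono]
      refine Finset.sum_congr rfl fun p _ => Finset.sum_congr rfl fun q _ => ?_
      ring
    simp only [e1]
    rw [Finset.sum_congr rfl fun i _ => Finset.sum_comm, Finset.sum_comm]
    refine Finset.sum_congr rfl fun p _ => ?_
    rw [Finset.sum_congr rfl fun i _ => Finset.sum_comm, Finset.sum_comm]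
    refine Finset.sum_congr rfl fun q _ => ?_
    simp only [← Finset.mul_sum, ← Finset.sum_mul]
    rw [sum_iteratedDeriv_mono, sum_iteratedDeriv_mono, ← hc,
      show (c₁ + c₂) * (z + w) = c₂ * z + c₁ * w + (c₁ * z + c₂ * w) by ring, Complex.exp_add,
      Complex.exp_add, Complex.exp_add (c₁ * z)]
    ring
  rw [← hsum]
  simp only [hpt]
  have hi2 : ∀ p q, IntegrableOn (fun x => symbolCoeff m a Z W p q x *
      Complex.exp (c * (lin Z x + lin W x))) Ω := fun p q =>
    integrableOn_of_continuousOn_closure hΩ.isBounded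
      ((continuousOn_symbolCoeff ha Z W p q).mul (hcF c))
  rw [integral_finsetSum _ fun p _ => integrable_finsetSum _ fun q _ =>
    ((hi2 p q).mul_const _).mul_const _]
  refine Finset.sum_congr rfl fun p _ => ?_
  rw [integral_finsetSum _ fun q _ => ((hi2 p q).mul_const _).mul_const _]
  refine Finset.sum_congr rfl fun q _ => ?_
  rw [integral_mul_const, integral_mul_const]

/-- For isotropic `Z`, `W` and `c ≠ 0` the integrals `∫_Ω s_{pq} e^{c(Z·x + W·x)}` all vanish. The two
choices `(c₁, c₂) = (c, 0)` and `(0, c)` give the conditions on columns and rows. -/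
theorem setIntegral_symbolCoeff_eq_zero {Ω : Set (Space n)} (hΩ : IsSmoothBoundedDomain Ω) {m : ℕ}
    (hm : 1 ≤ m) {a : (l : ℕ) → Space n → (Fin l → Fin n) → ℂ}
    (ha : ∀ l ≤ 2 * m - 2, IsSmoothSymmTensorField Ω (a l))
    (h : ∀ u v : Space n → ℂ, MemH (2 * m) Ω u → MemH (2 * m) Ω v →
      IsPolyharmonic m Ω u → IsPolyharmonic m Ω v →
      ∫ x in Ω, (∑ l ∈ Finset.Icc 0 (2 * m - 2), ∑ I : Fin l → Fin n,
        a l x I * weakDeriv Ω I u x) * v x = 0)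
    {Z W : Fin n → ℂ} (hZ : ∑ i, Z i * Z i = 0) (hW : ∑ i, W i * W i = 0)
    {c : ℂ} (hc : c ≠ 0) (p q : ℕ) :
    ∫ x in Ω, symbolCoeff m a Z W p q x * Complex.exp (c * (lin Z x + lin W x)) = 0 := by
  -- The factor without exponential only sees the term `q = j`.
  have hd : ∀ q j : ℕ, (q.descFactorial j : ℂ) * 0 ^ (q - j) =
      if q = j then (j.factorial : ℂ) else 0 := fun q j => by
    split_ifs with h
    · subst h; simp [Nat.descFactorial_self]
    · rcases lt_or_gt_of_ne h with h | h
      · rw [Nat.descFactorial_eq_zero_iff_lt.2 h]; simp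
      · rw [zero_pow (by lia), mul_zero]
  have hfac : ∀ j : ℕ, (j.factorial : ℂ) ≠ 0 := fun j => by exact_mod_cast j.factorial_ne_zero
  refine bidegree_coeff_eq_zero hc hm (g := fun p q => ∫ x in Ω, symbolCoeff m a Z W p q x *
    Complex.exp (c * (lin Z x + lin W x))) (fun p q hpq => ?_) (fun j hj k hk => ?_)
    (fun j hj k hk => ?_) p q
  · simp only [symbolCoeff_eq_zero a Z W hpq, zero_mul, integral_zero]
  · have key := sum_setIntegral_symbolCoeff hΩ hm ha h hZ hW (c₁ := c) (c₂ := 0) (add_zero c)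
      (.inr rfl) hj hk
    have hj' : j ∈ Finset.range (2 * m - 1) := Finset.mem_range.2 (by lia)
    simp only [hd, mul_ite, mul_zero, Finset.sum_ite_eq', if_pos hj'] at key
    rw [← Finset.sum_mul] at key
    exact (mul_eq_zero.1 key).resolve_right (hfac j)
  · have key := sum_setIntegral_symbolCoeff hΩ hm ha h hZ hW (c₁ := 0) (c₂ := c) (zero_add c)
      (.inl rfl) hk hj
    have hj' : j ∈ Finset.range (2 * m - 1) := Finset.mem_range.2 (by lia)
    rw [Finset.sum_comm] at key
    simp only [hd, mul_ite, mul_zero, ite_mul, zero_mul, Finset.sum_ite_eq', if_pos hj'] at key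
    simp only [mul_right_comm _ (j.factorial : ℂ)] at key
    rw [← Finset.sum_mul] at key
    exact (mul_eq_zero.1 key).resolve_right (hfac j)

/-! ### Symmetric tensors and Fourier inversion -/

/-- Two multi-indices with the same entries up to order differ by a permutation. -/
theorem exists_perm_of_sum_single_eq {l : ℕ} {I J : Fin l → Fin n}
    (h : ∑ i, Finsupp.single (I i) 1 = ∑ i, (Finsupp.single (J i) 1 : Fin n →₀ ℕ)) :
    ∃ σ : Equiv.Perm (Fin l), I ∘ σ = J := by
  have hcard : ∀ b, Fintype.card {i // J i = b} = Fintype.card {i // I i = b} := fun b => by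
    have hb := DFunLike.congr_fun h b
    simp only [Finsupp.finsetSum_apply, Finsupp.single_apply, Finset.sum_boole, Nat.cast_id] at hb
    rw [Fintype.card_subtype, Fintype.card_subtype, hb]
  refine ⟨(Equiv.sigmaFiberEquiv J).symm.trans
    ((Equiv.sigmaCongrRight fun b => Fintype.equivOfCardEq (hcard b)).trans
      (Equiv.sigmaFiberEquiv I)), ?_⟩
  ext i
  exact congrArg Fin.val (Fintype.equivOfCardEq (hcard (J i)) ⟨i, rfl⟩).2

/-- A symmetric array is determined by the homogeneous polynomial it defines on `ℝⁿ`. -/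
theorem eq_zero_of_sum_mul_prod_eq_zero {l : ℕ} {b : (Fin l → Fin n) → ℂ}
    (hsymm : ∀ (σ : Equiv.Perm (Fin l)) I, b (I ∘ σ) = b I)
    (h : ∀ ζ : Fin n → ℝ, ∑ I, b I * ∏ i, (ζ (I i) : ℂ) = 0) (J : Fin l → Fin n) : b J = 0 := by
  classical
  set μ : (Fin l → Fin n) → (Fin n →₀ ℕ) := fun I => ∑ i, Finsupp.single (I i) 1 with hμ
  set P : MvPolynomial (Fin n) ℂ := ∑ I, MvPolynomial.monomial (μ I) (b I) with hP
  have hP0 : P = 0 := by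
    refine MvPolynomial.funext_set (fun _ => Set.range ((↑) : ℝ → ℂ))
      (fun _ => Set.infinite_range_of_injective Complex.ofReal_injective) fun x hx => ?_
    choose ζ hζ using fun i => hx i (mem_univ i)
    obtain rfl : (fun i => (ζ i : ℂ)) = x := funext hζ
    rw [map_zero, ← h ζ, hP, map_sum]
    refine Finset.sum_congr rfl fun I _ => ?_
    have : MvPolynomial.monomial (μ I) (b I) = MvPolynomial.C (b I) *
        ∏ i, (MvPolynomial.X (I i) : MvPolynomial (Fin n) ℂ) := by
      simp only [MvPolynomial.X, ← MvPolynomial.monomial_sum_one, hμ]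
      rw [MvPolynomial.C_mul_monomial, mul_one]
    simp [this]
  have hc : P.coeff (μ J) = 0 := by rw [hP0, MvPolynomial.coeff_zero]
  rw [hP, MvPolynomial.coeff_sum] at hc
  simp only [MvPolynomial.coeff_monomial] at hc
  have e : ∀ I, (if μ I = μ J then b I else 0) = if μ I = μ J then b J else 0 := fun I => by
    split_ifs with hIJ
    · obtain ⟨σ, rfl⟩ := exists_perm_of_sum_single_eq hIJ
      exact (hsymm σ I).symm
    · rfl
  simp only [e] at hc
  rw [← Finset.sum_filter, Finset.sum_const, nsmul_eq_mul] at hc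
  refine (mul_eq_zero.1 hc).resolve_left ?_
  have : J ∈ Finset.univ.filter fun I => μ I = μ J := by simp
  exact_mod_cast (Finset.card_pos.2 ⟨J, this⟩).ne'

/-- The homogeneous parts of a symbol which vanishes on `ℝⁿ` vanish separately. -/
theorem eq_zero_of_sum_sum_mul_prod_eq_zero {N : ℕ} {b : (l : ℕ) → (Fin l → Fin n) → ℂ}
    (hsymm : ∀ l ≤ N, ∀ (σ : Equiv.Perm (Fin l)) I, b l (I ∘ σ) = b l I)
    (h : ∀ ζ : Fin n → ℝ, ∑ l ∈ Finset.Icc 0 N, ∑ I, b l I * ∏ i, (ζ (I i) : ℂ) = 0)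
    {l : ℕ} (hl : l ≤ N) (J : Fin l → Fin n) : b l J = 0 := by
  refine eq_zero_of_sum_mul_prod_eq_zero (hsymm l hl) (fun ζ => ?_) J
  set P : Polynomial ℂ := ∑ l ∈ Finset.Icc 0 N,
    Polynomial.monomial l (∑ I, b l I * ∏ i, (ζ (I i) : ℂ)) with hP
  have hP0 : P = 0 := by
    refine Polynomial.eq_zero_of_infinite_isRoot _ <|
      (Set.infinite_range_of_injective Complex.ofReal_injective).mono ?_
    rintro _ ⟨t, rfl⟩
    change P.eval _ = 0
    rw [← h fun i => t * ζ i, hP, Polynomial.eval_finsetSum]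
    refine Finset.sum_congr rfl fun l _ => ?_
    rw [Polynomial.eval_monomial, Finset.sum_mul]
    refine Finset.sum_congr rfl fun I _ => ?_
    push_cast
    rw [Finset.prod_mul_distrib]
    simp
    ring
  have hc : P.coeff l = 0 := by rw [hP0, Polynomial.coeff_zero]
  rw [hP, Polynomial.finsetSum_coeff] at hc
  simp only [Polynomial.coeff_monomial] at hc
  rwa [Finset.sum_ite_eq', if_pos (Finset.mem_Icc.2 ⟨l.zero_le, hl⟩)] at hc

/-- Given a unit vector `e`, every vector lies in the span of `e` and a unit vector orthogonal
to `e`. -/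
theorem exists_orthogonal_unit_span (hn : 2 ≤ n) {e : Space n} (he : ‖e‖ = 1) (ζ : Space n) :
    ∃ (f : Space n) (s t : ℝ), ‖f‖ = 1 ∧ inner ℝ e f = 0 ∧ ζ = s • e + t • f := by
  set r : Space n := ζ - inner ℝ e ζ • e with hr
  have her : inner ℝ e r = 0 := by
    rw [hr, inner_sub_right, inner_smul_right, real_inner_self_eq_norm_sq, he]; ring
  by_cases h0 : r = 0
  · have hbot : (Submodule.span ℝ {e})ᗮ ≠ ⊥ := fun hb => by
      have htop := (Submodule.orthogonal_eq_bot_iff).1 hb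
      have h1 := finrank_span_singleton (K := ℝ) (v := e) (by rintro rfl; simp at he)
      rw [htop, finrank_top, finrank_euclideanSpace_fin] at h1
      lia
    obtain ⟨g, hg, hg0⟩ := Submodule.exists_mem_ne_zero_of_ne_bot hbot
    refine ⟨(‖g‖⁻¹ : ℝ) • g, inner ℝ e ζ, 0, norm_smul_inv_norm (𝕜 := ℝ) hg0, ?_, ?_⟩
    · rw [inner_smul_right, Submodule.mem_orthogonal_singleton_iff_inner_right.1 hg, mul_zero]
    · rw [zero_smul, add_zero]; exact sub_eq_zero.1 h0
  · refine ⟨(‖r‖⁻¹ : ℝ) • r, inner ℝ e ζ, ‖r‖, norm_smul_inv_norm (𝕜 := ℝ) h0, ?_, ?_⟩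
    · rw [inner_smul_right, her, mul_zero]
    · rw [smul_smul, mul_inv_cancel₀ (norm_ne_zero_iff.2 h0), one_smul, hr]; abel

/-- If `e`, `f` are orthonormal then the complex vectors `e ± i f` are isotropic. -/
theorem sum_mul_self_isotropic {e f : Space n} (he : ‖e‖ = 1) (hf : ‖f‖ = 1)
    (hef : inner ℝ e f = 0) {τ : ℂ} (hτ : τ ^ 2 = -1) :
    ∑ i, ((e i : ℂ) + τ * f i) * ((e i : ℂ) + τ * f i) = 0 := by
  have h1 : ∑ i, (e i : ℂ) * e i = 1 := by
    have := real_inner_self_eq_norm_sq e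
    rw [he, PiLp.inner_apply] at this
    simpa [← sq] using congrArg ((↑) : ℝ → ℂ) this
  have h2 : ∑ i, (f i : ℂ) * f i = 1 := by
    have := real_inner_self_eq_norm_sq f
    rw [hf, PiLp.inner_apply] at this
    simpa [← sq] using congrArg ((↑) : ℝ → ℂ) this
  have h3 : ∑ i, (e i : ℂ) * f i = 0 := by
    rw [PiLp.inner_apply] at hef
    simpa [mul_comm] using congrArg ((↑) : ℝ → ℂ) hef
  have e1 : ∀ i, ((e i : ℂ) + τ * f i) * ((e i : ℂ) + τ * f i) =
      (e i : ℂ) * e i + τ ^ 2 * ((f i : ℂ) * f i) + 2 * τ * ((e i : ℂ) * f i) := fun i => by ring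
  simp only [e1, Finset.sum_add_distrib, ← Finset.mul_sum, h1, h2, h3, hτ]
  ring

/-- The Fourier transform of `x ↦ ∑ₗ ∑_I a^l_I(x) ζ_{i₁} ⋯ ζ_{iₗ}` on `Ω` vanishes away from the
origin. -/
theorem setIntegral_exp_mul_symbol_eq_zero (hn : 2 ≤ n) {Ω : Set (Space n)}
    (hΩ : IsSmoothBoundedDomain Ω) {m : ℕ}
    (hm : 1 ≤ m) {a : (l : ℕ) → Space n → (Fin l → Fin n) → ℂ}
    (ha : ∀ l ≤ 2 * m - 2, IsSmoothSymmTensorField Ω (a l))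
    (h : ∀ u v : Space n → ℂ, MemH (2 * m) Ω u → MemH (2 * m) Ω v →
      IsPolyharmonic m Ω u → IsPolyharmonic m Ω v →
      ∫ x in Ω, (∑ l ∈ Finset.Icc 0 (2 * m - 2), ∑ I : Fin l → Fin n,
        a l x I * weakDeriv Ω I u x) * v x = 0)
    (ζ : Space n) {ξ : Space n} (hξ : ξ ≠ 0) :
    ∫ x in Ω, Complex.exp (↑(-2 * Real.pi * inner ℝ x ξ) * Complex.I) *
      ∑ l ∈ Finset.Icc 0 (2 * m - 2), ∑ I : Fin l → Fin n, a l x I * ∏ i, (ζ (I i) : ℂ) = 0 := by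
  have hξ' : ‖ξ‖ ≠ 0 := norm_ne_zero_iff.2 hξ
  set e : Space n := (‖ξ‖⁻¹ : ℝ) • ξ with he_def
  have he : ‖e‖ = 1 := norm_smul_inv_norm (𝕜 := ℝ) hξ
  obtain ⟨f, s, t, hf, hef, rfl⟩ := exists_orthogonal_unit_span hn he ζ
  set Z : Fin n → ℂ := fun i => (e i : ℂ) + Complex.I * f i with hZd
  set W : Fin n → ℂ := fun i => (e i : ℂ) + -Complex.I * f i with hWd
  have hZ : ∑ i, Z i * Z i = 0 := sum_mul_self_isotropic he hf hef Complex.I_sq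
  have hW : ∑ i, W i * W i = 0 := sum_mul_self_isotropic he hf hef (by simp)
  set c : ℂ := -(Real.pi * ‖ξ‖ : ℝ) * Complex.I with hcd
  have hc : c ≠ 0 := mul_ne_zero (neg_ne_zero.2 (by exact_mod_cast mul_ne_zero Real.pi_ne_zero hξ'))
    Complex.I_ne_zero
  have hlin : ∀ x, ↑(-2 * Real.pi * inner ℝ x ξ) * Complex.I = c * (lin Z x + lin W x) := by
    intro x
    have h1 : lin Z x + lin W x = 2 * ((inner ℝ x e : ℝ) : ℂ) := by
      rw [lin_apply, lin_apply, ← Finset.sum_add_distrib, PiLp.inner_apply]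
      push_cast
      rw [Finset.mul_sum]
      refine Finset.sum_congr rfl fun i _ => ?_
      simp [hZd, hWd]
      ring
    have h2 : inner ℝ x ξ = ‖ξ‖ * inner ℝ x e := by
      rw [he_def, inner_smul_right, ← mul_assoc, mul_inv_cancel₀ hξ', one_mul]
    rw [h1, h2, hcd]
    push_cast
    ring
  have hζ : ∀ i, (((s • e + t • f : Space n) i : ℝ) : ℂ) =
      ((s - t * Complex.I) / 2) * Z i + ((s + t * Complex.I) / 2) * W i := by
    intro i
    simp only [PiLp.add_apply, PiLp.smul_apply, smul_eq_mul, hZd, hWd]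
    push_cast
    linear_combination ((t : ℂ) * f i) * Complex.I_sq
  simp only [hlin, hζ, sum_mul_prod hm, Finset.mul_sum]
  have hint : ∀ p q, IntegrableOn (fun x => Complex.exp (c * (lin Z x + lin W x)) *
      (symbolCoeff m a Z W p q x *
        (((s - t * Complex.I) / 2) ^ p * ((s + t * Complex.I) / 2) ^ q))) Ω := fun p q =>
    integrableOn_of_continuousOn_closure hΩ.isBounded
      (ContinuousOn.mul (by fun_prop)
        ((continuousOn_symbolCoeff ha Z W p q).mul continuousOn_const))
  rw [integral_finsetSum _ fun p _ => integrable_finsetSum _ fun q _ => hint p q]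
  refine Finset.sum_eq_zero fun p _ => ?_
  rw [integral_finsetSum _ fun q _ => hint p q]
  refine Finset.sum_eq_zero fun q _ => ?_
  have := setIntegral_symbolCoeff_eq_zero hΩ hm ha h hZ hW hc p q
  rw [← zero_mul (((s - t * Complex.I) / 2) ^ p * ((s + t * Complex.I) / 2) ^ q), ← this,
    ← integral_mul_const]
  congr 1
  ext x
  ring

open scoped FourierTransform in
/-- Fourier inversion on a bounded open set: a function continuous up to the boundary of `Ω` whose
Fourier transform vanishes off the origin is zero in `Ω`. -/
theorem eq_zero_of_setIntegral_exp_mul_eq_zero (hn : 1 ≤ n) {Ω : Set (Space n)} (ho : IsOpen Ω)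
    (hb : Bornology.IsBounded Ω) {f : Space n → ℂ} (hf : ContinuousOn f (closure Ω))
    (h : ∀ ξ : Space n, ξ ≠ 0 →
      ∫ x in Ω, Complex.exp (↑(-2 * Real.pi * inner ℝ x ξ) * Complex.I) * f x = 0)
    {x : Space n} (hx : x ∈ Ω) : f x = 0 := by
  have : Nonempty (Fin n) := ⟨⟨0, hn⟩⟩
  set g : Space n → ℂ := Ω.indicator f with hg
  have hgi : Integrable g :=
    (integrable_indicator_iff ho.measurableSet).2 (integrableOn_of_continuousOn_closure hb hf)
  have hF : ∀ ξ : Space n, ξ ≠ 0 → 𝓕 g ξ = 0 := fun ξ hξ => by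
    rw [Real.fourier_eq', ← h ξ hξ, ← integral_indicator ho.measurableSet]
    congr 1
    ext y
    by_cases hy : y ∈ Ω <;> simp [hg, hy]
  -- The origin is a null set because `n ≥ 1`.
  have hae : 𝓕 g =ᵐ[volume] 0 := by
    filter_upwards [(measure_eq_zero_iff_ae_notMem.1 (measure_singleton (0 : Space n)))] with ξ hξ
    exact hF ξ (by simpa using hξ)
  have hcont : ContinuousAt g x := by
    refine ((hf x (subset_closure hx)).mono subset_closure).continuousAt (ho.mem_nhds hx)
      |>.congr ?_
    filter_upwards [ho.mem_nhds hx] with y hy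
    simp [hg, hy]
  have hinv := hgi.fourierInv_fourier_eq ((integrable_zero _ _ _).congr hae.symm) hcont
  rw [Real.fourierInv_eq'] at hinv
  have hgx : g x = f x := by simp [hg, hx]
  rw [← hgx, ← hinv]
  refine integral_eq_zero_of_ae ?_
  filter_upwards [hae] with ξ hξ
  simp [hξ]

end PolyharmonicCalderon

end

theorem theorem2p1 (n m : ℕ) (hn : 3 ≤ n) (hm : 1 ≤ m)
    (Ω : Set (PolyharmonicCalderon.Space n))
    (hΩ : PolyharmonicCalderon.IsSmoothBoundedDomain Ω)
    (a : (l : ℕ) → PolyharmonicCalderon.Space n → (Fin l → Fin n) → ℂ)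
    (ha : ∀ l ≤ 2 * m - 2, PolyharmonicCalderon.IsSmoothSymmTensorField Ω (a l))
    (h : ∀ u v : PolyharmonicCalderon.Space n → ℂ,
      PolyharmonicCalderon.MemH (2 * m) Ω u → PolyharmonicCalderon.MemH (2 * m) Ω v →
      PolyharmonicCalderon.IsPolyharmonic m Ω u → PolyharmonicCalderon.IsPolyharmonic m Ω v →
      ∫ x in Ω, (∑ l ∈ Finset.Icc 0 (2 * m - 2), ∑ I : Fin l → Fin n,
        a l x I * PolyharmonicCalderon.weakDeriv Ω I u x) * v x = 0) :
    ∀ l ≤ 2 * m - 2, ∀ x ∈ Ω, ∀ I : Fin l → Fin n, a l x I = 0 := by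
  intro l hl x hx I
  refine PolyharmonicCalderon.eq_zero_of_sum_sum_mul_prod_eq_zero (b := fun l => a l x)
    (fun l hl => (ha l hl).symm x (subset_closure hx)) (fun ζ => ?_) hl I
  refine PolyharmonicCalderon.eq_zero_of_setIntegral_exp_mul_eq_zero
    (f := fun x => ∑ l ∈ Finset.Icc 0 (2 * m - 2), ∑ I : Fin l → Fin n,
      a l x I * ∏ i, (ζ (I i) : ℂ)) (by lia) hΩ.isOpen hΩ.isBounded ?_ (fun ξ hξ => ?_) hx
  · exact continuousOn_finsetSum _ fun l hl => continuousOn_finsetSum _ fun I _ =>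
      ((ha l (Finset.mem_Icc.1 hl).2).contDiffOn I).continuousOn.mul continuousOn_const
  · exact PolyharmonicCalderon.setIntegral_exp_mul_symbol_eq_zero (by lia) hΩ hm ha h
      (WithLp.toLp 2 ζ) hξ
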